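/- Let $X\in\mathbb R^{n\times k}$ have full column rank $k$, with rows $x_1^T,\dots,x_n^T$. For $\nu>2$, $\gamma>0$ let $f_\nu$ be the Student $t$ density with $\nu$ degrees of freedom, let $$m(\gamma,\nu)=\frac{2\nu\,\Gamma(\frac{\nu+1}{2})}{\sqrt{\pi\nu}\,(\nu-1)\,\Gamma(\frac{\nu}{2})}\Big(\gamma-\frac1\gamma\Big),$$ and let $\mathrm{ctpt}(\gamma,\nu)$ be the distribution with density $$p(\varepsilon\mid\gamma,\nu)=\frac{2}{\gamma+\frac1\gamma}\Big[f_\nu\Big(\tfrac{\varepsilon+m(\gamma,\nu)}{\gamma}\Big)I_{[-m(\gamma,\nu),\infty)}(\varepsilon)+f_\nu\big(\gamma(\varepsilon+m(\gamma,\nu))\big)I_{(-\infty,-m(\gamma,\nu))}(\varepsilon)\Big].$$ Consider the linear regression $y_i=x_i^T\beta+\sigma\varepsilon_i$, $i=1,\dots,n$, with $\beta\in\mathbb R^k$, $\sigma>0$ and $\varepsilon_i$ independent with distribution $\mathrm{ctpt}(\gamma,\nu)$, under a prior for which $(\beta,\sigma)$, $\gamma$ and $\nu$ are independent, $(\beta,\sigma)$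 has the improper density $p(\beta,\sigma)\propto\sigma^{-1}$, $\gamma$ has any probability distribution $P_\gamma$ on an interval $[a,b]$ with $0<a\le1\le b<\infty$, and $\nu$ has any probability distribution $P_\nu$ on $(2,\infty)$. (i) For every $y\in\mathbb R^n$ outside the column space of $X$ and every such prior for which the posterior distribution given $y$ is proper, and for every real $r\ge0$, $$\mathbb E(\sigma^r\mid y_1,\dots,y_n)<\infty\iff r<n-k.$$ (ii) For Lebesgue-almost every $y\in\mathbb R^n$, if $y$ is outside the column space of $X$, then the posterior is proper for every such prior (the null set depends only on $X$). Hence, for almost every such $y$, the equivalence in (i) holds for every such prior and every $r\ge0$. -/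

import Mathlib

open MeasureTheory Set
open scoped ENNReal

namespace CTPT

noncomputable section

/-- The density `f_ν` of the Student `t` distribution with `ν` degrees of freedom. -/
def studentPDF (ν x : ℝ) : ℝ :=
  Real.Gamma ((ν + 1) / 2) / (Real.sqrt (Real.pi * ν) * Real.Gamma (ν / 2)) *
    (1 + x ^ 2 / ν) ^ (-((ν + 1) / 2))

/-- The mean `m(γ, ν)` of the uncentred two-piece Student `t` distribution. -/
def twoPieceMean (γ ν : ℝ) : ℝ :=
  2 * ν * Real.Gamma ((ν + 1) / 2) /
      (Real.sqrt (Real.pi * ν) * (ν - 1) * Real.Gamma (ν / 2)) *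
    (γ - 1 / γ)

/-- The density of the centred two-piece Student `t` distribution `ctpt(γ, ν)`. -/
def ctptPDF (γ ν ε : ℝ) : ℝ :=
  2 / (γ + 1 / γ) *
    ((Ici (-twoPieceMean γ ν)).indicator
        (fun e => studentPDF ν ((e + twoPieceMean γ ν) / γ)) ε +
      (Iio (-twoPieceMean γ ν)).indicator
        (fun e => studentPDF ν (γ * (e + twoPieceMean γ ν))) ε)

/-- The parameters `(β, σ, γ, ν)`. -/
abbrev Param (k : ℕ) : Type := (Fin k → ℝ) × ℝ × ℝ × ℝ

variable {n k : ℕ}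

/-- The likelihood of `y` in the linear regression `y i = (x i)ᵀ β + σ ε i`, with independent
`ctpt(γ, ν)` errors `ε i`, where `(x i)ᵀ` is the `i`-th row of `X`. -/
def likelihood (X : Matrix (Fin n) (Fin k) ℝ) (y : Fin n → ℝ) : Param k → ℝ :=
  fun (β, σ, γ, ν) => ∏ i, σ⁻¹ * ctptPDF γ ν ((y i - X.mulVec β i) / σ)

/-- The improper prior of the scale: density `σ⁻¹` on `(0, ∞)`. -/
def scalePrior : Measure ℝ :=
  (volume.restrict (Ioi 0)).withDensity (fun σ => ENNReal.ofReal σ⁻¹)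

/-- The joint prior: `(β, σ)` has density `σ⁻¹` on `ℝᵏ × (0, ∞)`, independently of `γ ∼ Pγ` and
`ν ∼ Pν`. (The constant of proportionality is immaterial for the posterior.) -/
def prior (k : ℕ) (Pγ Pν : Measure ℝ) : Measure (Param k) :=
  (volume : Measure (Fin k → ℝ)).prod (scalePrior.prod (Pγ.prod Pν))

/-- `Pγ` is a probability measure on some `[a, b]` with `0 < a ≤ 1 ≤ b < ∞`, and `Pν` is a
probability measure on `(2, ∞)`. -/
structure AdmissiblePriors (Pγ Pν : Measure ℝ) : Prop where
  isProbabilityMeasure_skewness : IsProbabilityMeasure Pγ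
  isProbabilityMeasure_tail : IsProbabilityMeasure Pν
  skewness_support : ∃ a b : ℝ, 0 < a ∧ a ≤ 1 ∧ 1 ≤ b ∧ Pγ (Icc a b)ᶜ = 0
  tail_support : Pν (Ioi 2)ᶜ = 0

/-- The product of prior and likelihood. -/
def unnormalizedPosterior (X : Matrix (Fin n) (Fin k) ℝ) (y : Fin n → ℝ) (Pγ Pν : Measure ℝ) :
    Measure (Param k) :=
  (prior k Pγ Pν).withDensity (fun θ => ENNReal.ofReal (likelihood X y θ))

/-- The normalizing constant of the posterior. -/
def evidence (X : Matrix (Fin n) (Fin k) ℝ) (y : Fin n → ℝ) (Pγ Pν : Measure ℝ) : ℝ≥0∞ :=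
  unnormalizedPosterior X y Pγ Pν univ

/-- The posterior is proper, i.e. exists as a probability measure. -/
def PosteriorProper (X : Matrix (Fin n) (Fin k) ℝ) (y : Fin n → ℝ) (Pγ Pν : Measure ℝ) : Prop :=
  0 < evidence X y Pγ Pν ∧ evidence X y Pγ Pν < ∞

/-- The posterior of `(β, σ, γ, ν)` given `y`; meaningful when `PosteriorProper` holds. -/
def posterior (X : Matrix (Fin n) (Fin k) ℝ) (y : Fin n → ℝ) (Pγ Pν : Measure ℝ) :
    Measure (Param k) :=
  (evidence X y Pγ Pν)⁻¹ • unnormalizedPosterior X y Pγ Pν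

/-- The posterior moment `E(σ ^ r | y)`, with values in `[0, ∞]`. -/
def scaleMoment (X : Matrix (Fin n) (Fin k) ℝ) (y : Fin n → ℝ) (Pγ Pν : Measure ℝ) (r : ℝ) :
    ℝ≥0∞ :=
  ∫⁻ θ, ENNReal.ofReal (θ.2.1 ^ r) ∂(posterior X y Pγ Pν)

end

end CTPT

/-! Uniformly over `γ ∈ [a, b]` and `ν > 2` the error density is at most a constant times the Cauchy
kernel; for each fixed `(γ, ν)` it is bounded below on bounded sets. Everything reduces to the
likelihood integrated over `β`, as a function `L(σ)`.

Large scales. Keeping the kernels of `k` observations whose rows form a basis and bounding the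
others by 1, the integral over `β` gives `L(σ) ≤ K σ^(k-n)` (`exists_betaLikelihood_le`).
Conversely, for `σ ≥ 1` the standardized residuals stay bounded on the ball `‖β‖ ≤ σ`, of volume
`(2σ)^k`, so `L(σ) ≥ c σ^(k-n)` (`exists_le_betaLikelihood`). Hence `∫ σ^(r-1) L(σ)` converges at
infinity iff `r < n - k`. On `(0, 1]` one has `σ^r ≤ 1`, so that part of the moment is dominated by
the evidence, which is finite by propriety. This gives (i). The upper bound is uniform in `(γ, ν)`
and so survives averaging over any prior; for divergence a pointwise lower bound suffices.

Small scales. Off finitely many hyperplanes of `y`, observations with dependent rows cannot all have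
small residuals (`ae_exists_residual_bound`). So for every `β` all residuals outside some row basis
are at least `δ`, and each of these `n - k` kernels is at most `(σ/δ)^2`. The powers add to `-n +
2(n-k) + k = n - k`, and `σ^(n-k-1)` is integrable at 0 because `k < n`. This gives (ii). -/

namespace CTPT

/-! ### Bounds for the error density -/

/-- The Cauchy kernel. -/
noncomputable def cauchyKernel (x : ℝ) : ℝ := (1 + x ^ 2)⁻¹

theorem cauchyKernel_pos (x : ℝ) : 0 < cauchyKernel x := by
  unfold cauchyKernel; positivity

theorem cauchyKernel_le_one (x : ℝ) : cauchyKernel x ≤ 1 :=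
  inv_le_one_of_one_le₀ (by nlinarith [sq_nonneg x])

theorem measurable_cauchyKernel : Measurable cauchyKernel := by
  unfold cauchyKernel; fun_prop

/-- Log-convexity of Gamma at the midpoint of `x` and `x + 1`. -/
theorem Gamma_add_half_le {x : ℝ} (hx : 0 < x) :
    Real.Gamma (x + 1 / 2) ≤ √x * Real.Gamma x := by
  have h := Real.Gamma_mul_add_mul_le_rpow_Gamma_mul_rpow_Gamma hx (by linarith : 0 < x + 1)
    (by norm_num : (0 : ℝ) < 1 / 2) (by norm_num : (0 : ℝ) < 1 / 2) (by norm_num)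
  have hG := Real.Gamma_pos_of_pos hx
  rw [Real.Gamma_add_one hx.ne', ← Real.sqrt_eq_rpow, ← Real.sqrt_eq_rpow,
    Real.sqrt_mul hx.le] at h
  calc _ = Real.Gamma (1 / 2 * x + 1 / 2 * (x + 1)) := by congr 1; ring
    _ ≤ _ := h
    _ = √x * (√(Real.Gamma x) * √(Real.Gamma x)) := by ring
    _ = _ := by rw [Real.mul_self_sqrt hG.le]

theorem student_const_pos {ν : ℝ} (hν : 0 < ν) :
    0 < Real.Gamma ((ν + 1) / 2) / (√(Real.pi * ν) * Real.Gamma (ν / 2)) := by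
  have h1 := Real.Gamma_pos_of_pos (by linarith : 0 < (ν + 1) / 2)
  have h2 := Real.Gamma_pos_of_pos (by linarith : 0 < ν / 2)
  have := Real.pi_pos
  positivity

theorem student_const_le_one {ν : ℝ} (hν : 0 < ν) :
    Real.Gamma ((ν + 1) / 2) / (√(Real.pi * ν) * Real.Gamma (ν / 2)) ≤ 1 := by
  have h2 := Real.Gamma_pos_of_pos (by linarith : 0 < ν / 2)
  have hp := Real.pi_gt_three
  rw [div_le_one (by positivity)]
  calc _ = Real.Gamma (ν / 2 + 1 / 2) := by congr 1; ring
    _ ≤ √(ν / 2) * Real.Gamma (ν / 2) := Gamma_add_half_le (by positivity)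
    _ ≤ _ := by gcongr; nlinarith

theorem studentPDF_pos {ν : ℝ} (hν : 0 < ν) (x : ℝ) : 0 < studentPDF ν x :=
  mul_pos (student_const_pos hν) (by positivity)

/-- Bernoulli's inequality with exponent `(ν + 1) / 2 ≥ 1`: the factor `ν` cancels to first order,
which frees the bound from `ν`. -/
theorem studentPDF_le {ν : ℝ} (hν : 2 < ν) (x : ℝ) : studentPDF ν x ≤ (1 + x ^ 2 / 2)⁻¹ := by
  have h0 : 0 < ν := by linarith
  have hb : 1 + x ^ 2 / 2 ≤ (1 + x ^ 2 / ν) ^ ((ν + 1) / 2) := by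
    refine le_trans ?_ (one_add_mul_self_le_rpow_one_add (s := x ^ 2 / ν)
      (le_trans (by norm_num) (by positivity : 0 ≤ x ^ 2 / ν)) (by linarith))
    have : (ν + 1) / 2 * (x ^ 2 / ν) = x ^ 2 / 2 + x ^ 2 / (2 * ν) := by field_simp
    rw [this]
    have : 0 ≤ x ^ 2 / (2 * ν) := by positivity
    linarith
  unfold studentPDF
  rw [Real.rpow_neg (by positivity)]
  calc _ ≤ 1 * ((1 + x ^ 2 / ν) ^ ((ν + 1) / 2))⁻¹ := by
        gcongr; exact student_const_le_one h0
    _ ≤ _ := by rw [one_mul]; gcongr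

theorem studentPDF_anti {ν x y : ℝ} (hν : 0 < ν) (h : |x| ≤ |y|) :
    studentPDF ν y ≤ studentPDF ν x := by
  unfold studentPDF
  have hx : x ^ 2 ≤ y ^ 2 := sq_le_sq.mpr h
  have := (student_const_pos hν).le
  refine mul_le_mul_of_nonneg_left ?_ this
  refine Real.rpow_le_rpow_of_nonpos (by positivity) (by gcongr) (by linarith)

theorem abs_twoPieceMean_le {a b γ ν : ℝ} (ha : 0 < a) (hγ : γ ∈ Icc a b) (hν : 2 < ν) :
    |twoPieceMean γ ν| ≤ 4 * (b + 1 / a) := by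
  obtain ⟨h1, h2⟩ := hγ
  have hg : 0 < γ := by linarith
  have hc := student_const_pos (by linarith : 0 < ν)
  have hc1 := student_const_le_one (by linarith : 0 < ν)
  have h3 : 1 / γ ≤ 1 / a := by gcongr
  have h4 : |γ - 1 / γ| ≤ b + 1 / a := by
    have : 0 < 1 / γ := by positivity
    rw [abs_le]; constructor <;> linarith
  have h5 : twoPieceMean γ ν = 2 * (ν / (ν - 1)) *
      (Real.Gamma ((ν + 1) / 2) / (√(Real.pi * ν) * Real.Gamma (ν / 2))) * (γ - 1 / γ) := by
    unfold twoPieceMean; congr 1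
    have : ν - 1 ≠ 0 := by linarith
    have := (Real.Gamma_pos_of_pos (by linarith : 0 < ν / 2)).ne'
    have : √(Real.pi * ν) ≠ 0 := by have := Real.pi_pos; positivity
    field_simp
  have h6 : ν / (ν - 1) ≤ 2 := by rw [div_le_iff₀ (by linarith)]; linarith
  have h7 : 0 ≤ ν / (ν - 1) := div_nonneg (by linarith) (by linarith)
  rw [h5, abs_mul, abs_of_nonneg (by positivity)]
  gcongr
  nlinarith

theorem ctptPDF_eq (γ ν ε : ℝ) : ctptPDF γ ν ε = 2 / (γ + 1 / γ) *
    if -twoPieceMean γ ν ≤ ε then studentPDF ν ((ε + twoPieceMean γ ν) / γ)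
    else studentPDF ν (γ * (ε + twoPieceMean γ ν)) := by
  unfold ctptPDF
  split_ifs with h
  · simp [indicator, h]
  · simp [indicator, h, not_le.mp h]

theorem ctptPDF_pos {γ ν : ℝ} (hγ : 0 < γ) (hν : 0 < ν) (ε : ℝ) : 0 < ctptPDF γ ν ε := by
  rw [ctptPDF_eq]
  have : 0 < 2 / (γ + 1 / γ) := by positivity
  split_ifs <;> exact mul_pos this (studentPDF_pos hν _)

/-- A Cauchy upper bound, uniform in the tail parameter and for bounded skewness. -/
theorem exists_ctptPDF_le {a b : ℝ} (ha : 0 < a) (hb : 0 < b) : ∃ C : ℝ, 0 < C ∧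
    ∀ γ ∈ Icc a b, ∀ ν > 2, ∀ ε, ctptPDF γ ν ε ≤ C * cauchyKernel ε := by
  -- The two pieces scale their argument by `1/γ ≥ 1/b` and by `γ ≥ a`, hence both by at least `s`.
  set s := min a (1 / b) with hs
  have hs0 : 0 < s := lt_min ha (by positivity)
  set M := 4 * (b + 1 / a) with hM
  -- With `u = ε + m` and `|m| ≤ M`, `1 + ε² ≤ 1 + 2M² + 2u²`, and `2u² = (4/s²)·(su)²/2`.
  refine ⟨1 + 2 * M ^ 2 + 4 / s ^ 2, by positivity, fun γ hγ ν hν ε => ?_⟩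
  have hm := abs_twoPieceMean_le ha hγ hν
  have hg : 0 < γ := ha.trans_le hγ.1
  have hm2 : twoPieceMean γ ν ^ 2 ≤ M ^ 2 := sq_le_sq' (abs_le.mp hm).1 (abs_le.mp hm).2
  have hc : 2 / (γ + 1 / γ) ≤ 1 := by
    rw [div_le_one (by positivity)]
    have : γ + 1 / γ - 2 = (γ - 1) ^ 2 / γ := by field_simp; ring
    have : 0 ≤ (γ - 1) ^ 2 / γ := by positivity
    linarith
  set u := ε + twoPieceMean γ ν with hu
  have key : ∀ t, s ≤ t → studentPDF ν (t * u) ≤ (1 + (s * u) ^ 2 / 2)⁻¹ := by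
    intro t ht
    refine (studentPDF_le hν _).trans ?_
    rw [mul_pow, mul_pow]
    gcongr
  have h1 : ctptPDF γ ν ε ≤ 1 * (1 + (s * u) ^ 2 / 2)⁻¹ := by
    rw [ctptPDF_eq]
    refine mul_le_mul hc ?_ ?_ zero_le_one
    · split_ifs
      · rw [div_eq_inv_mul]
        apply key
        rw [← one_div]
        exact (min_le_right _ _).trans (one_div_le_one_div_of_le hg hγ.2)
      · exact key _ ((min_le_left _ _).trans hγ.1)
    · split_ifs <;> exact (studentPDF_pos (by linarith) _).le
  refine h1.trans ?_
  unfold cauchyKernel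
  rw [one_mul, ← div_eq_mul_inv, inv_eq_one_div, div_le_div_iff₀ (by positivity) (by positivity)]
  have h2 : ε ^ 2 ≤ 2 * u ^ 2 + 2 * M ^ 2 := by nlinarith [sq_nonneg (u + twoPieceMean γ ν)]
  have h3 : 4 / s ^ 2 * ((s * u) ^ 2 / 2) = 2 * u ^ 2 := by field_simp; ring
  have h4 : 0 ≤ (1 + 2 * M ^ 2) * ((s * u) ^ 2 / 2) := by positivity
  have h5 : 0 ≤ 4 / s ^ 2 := by positivity
  nlinarith

/-- The Student density decreases in `|x|`, and `B` dominates the arguments of both pieces. The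
constant may depend on `γ` and `ν`. -/
theorem exists_le_ctptPDF {γ ν : ℝ} (hγ : 0 < γ) (hν : 0 < ν) (R : ℝ) : ∃ c : ℝ, 0 < c ∧
    ∀ ε, |ε| ≤ R → c ≤ ctptPDF γ ν ε := by
  set B := (γ⁻¹ + γ) * (R + |twoPieceMean γ ν|)
  have hc : 0 < 2 / (γ + 1 / γ) := by positivity
  refine ⟨2 / (γ + 1 / γ) * studentPDF ν B, mul_pos hc (studentPDF_pos hν _), fun ε hε => ?_⟩
  have hu : |ε + twoPieceMean γ ν| ≤ R + |twoPieceMean γ ν| := (abs_add_le _ _).trans (by gcongr)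
  have hR : 0 ≤ R + |twoPieceMean γ ν| := (abs_nonneg _).trans hu
  have hi : 0 < γ⁻¹ := by positivity
  rw [ctptPDF_eq]
  refine mul_le_mul_of_nonneg_left ?_ hc.le
  split_ifs
  · refine studentPDF_anti hν ?_
    rw [abs_of_nonneg (a := B) (by positivity), div_eq_inv_mul, abs_mul, abs_of_pos hi]
    exact mul_le_mul (by linarith) hu (abs_nonneg _) (by positivity)
  · refine studentPDF_anti hν ?_
    rw [abs_of_nonneg (a := B) (by positivity), abs_mul, abs_of_pos hγ]
    exact mul_le_mul (by linarith) hu (abs_nonneg _) (by positivity)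

/-! ### Measurability of the likelihood -/

/-- The reciprocal of the complex Gamma function is entire, which avoids handling the poles. -/
theorem measurable_Gamma : Measurable Real.Gamma := by
  have h : Real.Gamma = fun x : ℝ => (((Complex.Gamma (x : ℂ))⁻¹)⁻¹).re := by
    funext x; rw [inv_inv, Complex.Gamma_ofReal, Complex.ofReal_re]
  rw [h]
  have h1 : Measurable fun s : ℂ => (Complex.Gamma s)⁻¹ :=
    Complex.differentiable_one_div_Gamma.continuous.measurable
  exact Complex.measurable_re.comp ((h1.comp Complex.measurable_ofReal).inv)

theorem measurable_studentPDF : Measurable fun p : ℝ × ℝ => studentPDF p.1 p.2 := by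
  unfold studentPDF
  have := measurable_Gamma
  fun_prop

theorem measurable_twoPieceMean : Measurable fun p : ℝ × ℝ => twoPieceMean p.1 p.2 := by
  unfold twoPieceMean
  have := measurable_Gamma
  fun_prop

theorem measurable_ctptPDF : Measurable fun p : ℝ × ℝ × ℝ => ctptPDF p.1 p.2.1 p.2.2 := by
  simp only [ctptPDF_eq]
  have hm : Measurable fun p : ℝ × ℝ × ℝ => twoPieceMean p.1 p.2.1 :=
    measurable_twoPieceMean.comp (by fun_prop : Measurable fun p : ℝ × ℝ × ℝ => (p.1, p.2.1))
  refine Measurable.mul (by fun_prop) (Measurable.ite ?_ ?_ ?_)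
  · exact measurableSet_le (by fun_prop) (by fun_prop)
  · exact measurable_studentPDF.comp (by fun_prop : Measurable fun p : ℝ × ℝ × ℝ =>
      (p.2.1, (p.2.2 + twoPieceMean p.1 p.2.1) / p.1))
  · exact measurable_studentPDF.comp (by fun_prop : Measurable fun p : ℝ × ℝ × ℝ =>
      (p.2.1, p.1 * (p.2.2 + twoPieceMean p.1 p.2.1)))

theorem measurable_likelihood {n k : ℕ} (X : Matrix (Fin n) (Fin k) ℝ) (y : Fin n → ℝ) :
    Measurable (likelihood X y) := by
  have : likelihood X y = fun θ : Param k => ∏ i, θ.2.1⁻¹ *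
      ctptPDF θ.2.2.1 θ.2.2.2 ((y i - X.mulVec θ.1 i) / θ.2.1) := rfl
  rw [this]
  refine Finset.measurable_prod _ fun i _ => Measurable.mul (by fun_prop) ?_
  have hX : Measurable fun β : Fin k → ℝ => X.mulVec β i := by
    unfold Matrix.mulVec dotProduct; fun_prop
  have hX' : Measurable fun θ : Param k => X.mulVec θ.1 i := hX.comp measurable_fst
  exact measurable_ctptPDF.comp (by fun_prop : Measurable fun θ : Param k =>
    (θ.2.2.1, θ.2.2.2, (y i - X.mulVec θ.1 i) / θ.2.1))

/-! ### Integrals of products of Cauchy kernels -/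

theorem integral_cauchyKernel_comp (c : ℝ) {σ : ℝ} (hσ : 0 < σ) :
    ∫ t, cauchyKernel ((c - t) / σ) = σ * Real.pi := by
  rw [integral_sub_left_eq_self (fun t => cauchyKernel (t / σ)) volume c,
    Measure.integral_comp_div, abs_of_pos hσ, smul_eq_mul]
  congr 1
  exact integral_univ_inv_one_add_sq

theorem integrable_cauchyKernel_comp (c : ℝ) {σ : ℝ} (hσ : 0 < σ) :
    Integrable fun t => cauchyKernel ((c - t) / σ) :=
  Integrable.comp_sub_left (f := fun t => cauchyKernel (t / σ))
    (Integrable.comp_div integrable_inv_one_add_sq hσ.ne') c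

/-- The substitution `t = Mβ` splits the integral into `k` one-dimensional ones, each equal to `σπ`.
-/
theorem lintegral_prod_cauchyKernel {k : ℕ} (M : Matrix (Fin k) (Fin k) ℝ) (hM : M.det ≠ 0)
    (v : Fin k → ℝ) {σ : ℝ} (hσ : 0 < σ) :
    ∫⁻ β : Fin k → ℝ, ENNReal.ofReal (∏ j, cauchyKernel ((v j - M.mulVec β j) / σ)) =
      ENNReal.ofReal (|M.det⁻¹| * Real.pi ^ k * σ ^ k) := by
  set g : (Fin k → ℝ) → ℝ≥0∞ :=
    fun t => ENNReal.ofReal (∏ j, cauchyKernel ((v j - t j) / σ)) with hg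
  have hgm : Measurable g := by
    have := measurable_cauchyKernel
    refine ENNReal.measurable_ofReal.comp (Finset.measurable_prod _ fun j _ => ?_)
    fun_prop
  have hlin : Measurable (Matrix.toLin' M) :=
    (LinearMap.continuous_of_finiteDimensional _).measurable
  have h1 : ∫⁻ β, g (Matrix.toLin' M β) = ∫⁻ t, g t ∂(Measure.map (Matrix.toLin' M) volume) :=
    (lintegral_map hgm hlin).symm
  have h2 : ∫⁻ t, g t = ENNReal.ofReal (∫ t : Fin k → ℝ, ∏ j, cauchyKernel ((v j - t j) / σ)) := by
    rw [ofReal_integral_eq_lintegral_ofReal]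
    · exact Integrable.fintype_prod (f := fun j t => cauchyKernel ((v j - t) / σ))
        fun j => integrable_cauchyKernel_comp (v j) hσ
    · exact Filter.Eventually.of_forall fun t =>
        Finset.prod_nonneg fun j _ => (cauchyKernel_pos _).le
  have h3 : ∫ t : Fin k → ℝ, ∏ j, cauchyKernel ((v j - t j) / σ) = (σ * Real.pi) ^ k := by
    rw [integral_fintype_prod_volume_eq_prod (fun j t => cauchyKernel ((v j - t) / σ))]
    simp [integral_cauchyKernel_comp _ hσ]
  rw [Real.map_matrix_volume_pi_eq_smul_volume_pi hM, lintegral_smul_measure, h2, h3,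
    smul_eq_mul, ← ENNReal.ofReal_mul (abs_nonneg _)] at h1
  simp only [hg, Matrix.toLin'_apply] at h1
  rw [h1, mul_pow]
  congr 1; ring

variable {n k : ℕ}

/-- `T` indexes a basis of the row space of `X`, assumed to be all of `ℝᵏ`. -/
def IsRowBasis (X : Matrix (Fin n) (Fin k) ℝ) (T : Finset (Fin n)) : Prop :=
  LinearIndepOn ℝ X.row (T : Set (Fin n)) ∧ T.card = k

theorem exists_lintegral_rowBasis (X : Matrix (Fin n) (Fin k) ℝ) {T : Finset (Fin n)}
    (hT : IsRowBasis X T) (y : Fin n → ℝ) : ∃ K : ℝ, 0 ≤ K ∧ ∀ σ > 0,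
    ∫⁻ β : Fin k → ℝ, ENNReal.ofReal (∏ i ∈ T, cauchyKernel ((y i - X.mulVec β i) / σ)) =
      ENNReal.ofReal (K * σ ^ k) := by
  obtain ⟨hli, hcard⟩ := hT
  let e : Fin k ≃ T := (T.equivFinOfCardEq hcard).symm
  let M : Matrix (Fin k) (Fin k) ℝ := X.submatrix (fun j => (e j : Fin n)) id
  have hM : M.det ≠ 0 := by
    have h1 : LinearIndependent ℝ M.row := by
      have h2 : LinearIndependent ℝ fun i : T => X.row i := hli
      exact h2.comp e e.injective
    have h2 := (Matrix.linearIndependent_rows_iff_isUnit).mp h1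
    exact ((Matrix.isUnit_iff_isUnit_det _).mp h2).ne_zero
  refine ⟨|M.det⁻¹| * Real.pi ^ k, by have := Real.pi_pos; positivity, fun σ hσ => ?_⟩
  rw [← lintegral_prod_cauchyKernel M hM (fun j => y (e j)) hσ]
  refine lintegral_congr fun β => ?_
  congr 1
  rw [← Finset.prod_coe_sort, ← e.prod_comp]
  rfl

/-! ### Row bases and residuals for generic `y` -/

theorem exists_rowBasis_superset {X : Matrix (Fin n) (Fin k) ℝ} (hX : X.rank = k)
    {S : Finset (Fin n)} (hS : LinearIndepOn ℝ X.row (S : Set (Fin n))) :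
    ∃ T, S ⊆ T ∧ IsRowBasis X T := by
  classical
  obtain ⟨b, -, hSb, hspan, hb⟩ := exists_linearIndepOn_extension hS (subset_univ _)
  refine ⟨b.toFinset, by simpa using hSb, by simpa using hb, ?_⟩
  rw [image_univ] at hspan
  have h1 : Submodule.span ℝ (X.row '' b) = Submodule.span ℝ (range X.row) :=
    le_antisymm (Submodule.span_mono (image_subset_range _ _)) (Submodule.span_le.mpr hspan)
  have h2 : Module.finrank ℝ (Submodule.span ℝ (range fun i : b => X.row i)) = Fintype.card b :=
    finrank_span_eq_card hb
  rw [Matrix.rank_eq_finrank_span_row, ← h1] at hX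
  rw [image_eq_range] at hX
  rw [toFinset_card, ← h2]
  exact hX

/-- A linear relation between the rows holds for almost no `y`. -/
theorem ae_dotProduct_ne_zero {c : Fin n → ℝ} (hc : c ≠ 0) :
    ∀ᵐ y : Fin n → ℝ, c ⬝ᵥ y ≠ 0 := by
  let L : (Fin n → ℝ) →ₗ[ℝ] ℝ := dotProductBilin ℝ ℝ c
  have hL : L.ker ≠ ⊤ := by
    intro h
    have : c ∈ L.ker := h ▸ Submodule.mem_top
    exact hc (dotProduct_self_eq_zero.mp this)
  have := Measure.addHaar_submodule (volume : Measure (Fin n → ℝ)) L.ker hL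
  rw [ae_iff]
  simp only [not_not]
  exact this

/-- Since `c` annihilates the column space, `c ⬝ᵥ y` is a combination of the residuals indexed by
`S`, whatever `β` is. -/
theorem exists_row_relation {X : Matrix (Fin n) (Fin k) ℝ} {S : Finset (Fin n)}
    (hS : ¬ LinearIndepOn ℝ X.row (S : Set (Fin n))) :
    ∃ c : Fin n → ℝ, c ≠ 0 ∧ (∀ i ∉ S, c i = 0) ∧ ∀ β, c ⬝ᵥ X.mulVec β = 0 := by
  classical
  rw [linearIndepOn_finset_iff] at hS
  push Not at hS
  obtain ⟨f, hf, i, hi, hfi⟩ := hS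
  refine ⟨fun i => if i ∈ S then f i else 0, fun h => hfi ?_, fun i hi => by simp [hi], ?_⟩
  · simpa [hi] using congrFun h i
  · intro β
    have h0 : Matrix.vecMul (fun i => if i ∈ S then f i else 0) X = 0 := by
      rw [← hf]
      ext j
      simp [Matrix.vecMul, dotProduct, Finset.sum_ite_mem, Matrix.row]
    rw [Matrix.dotProduct_mulVec, h0, zero_dotProduct]

/-- For generic `y`, every `β` leaves residuals bounded away from zero outside some row basis. -/
theorem ae_exists_residual_bound {X : Matrix (Fin n) (Fin k) ℝ} (hX : X.rank = k) :
    ∀ᵐ y : Fin n → ℝ, ∃ δ > 0, ∀ β, ∃ T, IsRowBasis X T ∧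
      ∀ i ∉ T, δ ≤ |y i - X.mulVec β i| := by
  classical
  have h : ∀ᵐ y : Fin n → ℝ, ∀ S : Finset (Fin n), ¬ LinearIndepOn ℝ X.row (S : Set (Fin n)) →
      ∃ c : Fin n → ℝ, (∀ i ∉ S, c i = 0) ∧ (∀ β, c ⬝ᵥ X.mulVec β = 0) ∧ c ⬝ᵥ y ≠ 0 := by
    refine ae_all_iff.mpr fun S => ?_
    by_cases hS : LinearIndepOn ℝ X.row (S : Set (Fin n))
    · exact Filter.Eventually.of_forall fun y h => absurd hS h
    · obtain ⟨c, hc, hcS, hcX⟩ := exists_row_relation hS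
      filter_upwards [ae_dotProduct_ne_zero hc] with y hy _
      exact ⟨c, hcS, hcX, hy⟩
  filter_upwards [h] with y hy
  have h2 : ∀ S : Finset (Fin n), ∃ d > 0, ¬ LinearIndepOn ℝ X.row (S : Set (Fin n)) →
      ∀ β, ∃ i ∈ S, d ≤ |y i - X.mulVec β i| := by
    intro S
    by_cases hS : LinearIndepOn ℝ X.row (S : Set (Fin n))
    · exact ⟨1, one_pos, fun h => absurd hS h⟩
    obtain ⟨c, hcS, hcX, hcy⟩ := hy S hS
    have hpos : 0 < 1 + ∑ i, |c i| := by positivity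
    -- Residuals below this `d` on all of `S` would give `|c ⬝ᵥ y| ≤ (∑ |c i|) d`, which is `|c ⬝ᵥ
    -- y| - d`.
    refine ⟨|c ⬝ᵥ y| / (1 + ∑ i, |c i|), div_pos (abs_pos.mpr hcy) hpos, fun _ β => ?_⟩
    by_contra! hlt
    set d := |c ⬝ᵥ y| / (1 + ∑ i, |c i|) with hd
    have hd0 : 0 < d := div_pos (abs_pos.mpr hcy) hpos
    have h3 : c ⬝ᵥ y = ∑ i, c i * (y i - X.mulVec β i) := by
      have := hcX β
      simp only [dotProduct] at this ⊢
      simp [mul_sub, Finset.sum_sub_distrib, this]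
    have h4 : |c ⬝ᵥ y| ≤ (∑ i, |c i|) * d := by
      rw [h3, Finset.sum_mul]
      refine (Finset.abs_sum_le_sum_abs _ _).trans (Finset.sum_le_sum fun i _ => ?_)
      rw [abs_mul]
      by_cases hi : i ∈ S
      · exact mul_le_mul_of_nonneg_left (hlt i hi).le (abs_nonneg _)
      · simp [hcS i hi]
    have h5 : |c ⬝ᵥ y| = d + (∑ i, |c i|) * d := by
      rw [hd]; field_simp
    linarith
  choose d hd0 hd using h2
  obtain ⟨S₀, hS₀⟩ := Finite.exists_min d
  refine ⟨d S₀, hd0 S₀, fun β => ?_⟩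
  -- The indices with residual below the least threshold have independent rows, so they extend to a
  -- row basis.
  let S := Finset.univ.filter fun i => |y i - X.mulVec β i| < d S₀
  have hS : LinearIndepOn ℝ X.row (S : Set (Fin n)) := by
    by_contra hS
    obtain ⟨i, hi, hle⟩ := hd S hS β
    have h1 : |y i - X.mulVec β i| < d S₀ := (Finset.mem_filter.mp hi).2
    linarith [hS₀ S]
  obtain ⟨T, hST, hT⟩ := exists_rowBasis_superset hX hS
  refine ⟨T, hT, fun i hi => ?_⟩
  by_contra! hlt
  exact hi (hST (Finset.mem_filter.mpr ⟨Finset.mem_univ _, hlt⟩))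

/-! ### Powers of `σ` bounding the integrated likelihood -/

/-- The likelihood integrated over the regression coefficients. -/
noncomputable def betaLikelihood (X : Matrix (Fin n) (Fin k) ℝ) (y : Fin n → ℝ) (σ : ℝ)
    (q : ℝ × ℝ) : ℝ≥0∞ :=
  ∫⁻ β : Fin k → ℝ, ENNReal.ofReal (likelihood X y (β, σ, q))

theorem likelihood_le (X : Matrix (Fin n) (Fin k) ℝ) (y : Fin n → ℝ) {C σ γ ν : ℝ}
    (hσ : 0 < σ) (hγ : 0 < γ) (hν : 0 < ν) (h : ∀ ε, ctptPDF γ ν ε ≤ C * cauchyKernel ε)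
    (β : Fin k → ℝ) : likelihood X y (β, σ, γ, ν) ≤
      (C / σ) ^ n * ∏ i, cauchyKernel ((y i - X.mulVec β i) / σ) := by
  have h1 : (C / σ) ^ n * ∏ i, cauchyKernel ((y i - X.mulVec β i) / σ) =
      ∏ i, (C / σ) * cauchyKernel ((y i - X.mulVec β i) / σ) := by
    rw [Finset.prod_mul_distrib]; simp [div_pow]
  rw [h1]
  refine Finset.prod_le_prod (fun i _ => ?_) fun i _ => ?_
  · exact mul_nonneg (inv_nonneg.mpr hσ.le) (ctptPDF_pos hγ hν _).le
  · rw [div_eq_inv_mul C, mul_assoc]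
    exact mul_le_mul_of_nonneg_left (h _) (inv_nonneg.mpr hσ.le)

theorem prod_cauchyKernel_le (X : Matrix (Fin n) (Fin k) ℝ) (y : Fin n → ℝ) (σ : ℝ)
    (β : Fin k → ℝ) (T : Finset (Fin n)) :
    ∏ i, cauchyKernel ((y i - X.mulVec β i) / σ) ≤
      ∏ i ∈ T, cauchyKernel ((y i - X.mulVec β i) / σ) := by
  classical
  rw [← Finset.prod_mul_prod_compl T]
  exact mul_le_of_le_one_right (Finset.prod_nonneg fun i _ => (cauchyKernel_pos _).le)
    (Finset.prod_le_one (fun i _ => (cauchyKernel_pos _).le) fun i _ => cauchyKernel_le_one _)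

theorem cauchyKernel_div_le {δ r σ : ℝ} (hδ : 0 < δ) (hσ : 0 < σ) (h : δ ≤ |r|) :
    cauchyKernel (r / σ) ≤ (σ / δ) ^ 2 := by
  have h1 : (δ / σ) ^ 2 ≤ (r / σ) ^ 2 := by
    rw [div_pow, div_pow]
    gcongr ?_ / _
    exact sq_le_sq.mpr (by rwa [abs_of_pos hδ])
  have h2 : (σ / δ) ^ 2 = ((δ / σ) ^ 2)⁻¹ := by rw [← inv_pow, inv_div]
  rw [h2]
  exact inv_anti₀ (by positivity) (by linarith)

theorem prod_cauchyKernel_le_of_residual (X : Matrix (Fin n) (Fin k) ℝ) (y : Fin n → ℝ)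
    {δ σ : ℝ} (hδ : 0 < δ) (hσ : 0 < σ) (β : Fin k → ℝ) {T : Finset (Fin n)} (hT : T.card = k)
    (h : ∀ i ∉ T, δ ≤ |y i - X.mulVec β i|) :
    ∏ i, cauchyKernel ((y i - X.mulVec β i) / σ) ≤
      ((σ / δ) ^ 2) ^ (n - k) * ∏ i ∈ T, cauchyKernel ((y i - X.mulVec β i) / σ) := by
  classical
  rw [← Finset.prod_compl_mul_prod T]
  refine mul_le_mul_of_nonneg_right ?_ (Finset.prod_nonneg fun i _ => (cauchyKernel_pos _).le)
  calc _ ≤ ∏ i ∈ Tᶜ, (σ / δ) ^ 2 := Finset.prod_le_prod (fun i _ => (cauchyKernel_pos _).le)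
        fun i hi => cauchyKernel_div_le hδ hσ (h i (Finset.mem_compl.mp hi))
    _ = _ := by simp [Finset.card_compl, hT]

theorem exists_betaLikelihood_le {X : Matrix (Fin n) (Fin k) ℝ} (hX : X.rank = k)
    (y : Fin n → ℝ) {a b : ℝ} (ha : 0 < a) (hb : 0 < b) : ∃ K : ℝ, 0 ≤ K ∧
      ∀ γ ∈ Icc a b, ∀ ν > 2, ∀ σ > 0,
        betaLikelihood X y σ (γ, ν) ≤ ENNReal.ofReal (K * σ ^ ((k : ℝ) - n)) := by
  obtain ⟨C, hC, hCle⟩ := exists_ctptPDF_le ha hb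
  -- Any row basis will do here; extending the empty set provides one.
  obtain ⟨T, -, hT⟩ := exists_rowBasis_superset (S := ∅) hX (by simp)
  obtain ⟨K, hK, hKeq⟩ := exists_lintegral_rowBasis X hT y
  refine ⟨C ^ n * K, by positivity, fun γ hγ ν hν σ hσ => ?_⟩
  have hν' : 0 < ν := by linarith
  calc betaLikelihood X y σ (γ, ν)
      ≤ ∫⁻ β : Fin k → ℝ, ENNReal.ofReal ((C / σ) ^ n) *
        ENNReal.ofReal (∏ i ∈ T, cauchyKernel ((y i - X.mulVec β i) / σ)) := by
        refine lintegral_mono fun β => ?_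
        rw [← ENNReal.ofReal_mul (by positivity)]
        refine ENNReal.ofReal_le_ofReal ((likelihood_le X y hσ (ha.trans_le hγ.1) hν'
          (hCle γ hγ ν hν) β).trans ?_)
        exact mul_le_mul_of_nonneg_left (prod_cauchyKernel_le X y σ β T) (by positivity)
    _ = _ := by
        rw [lintegral_const_mul' _ _ ENNReal.ofReal_ne_top, hKeq σ hσ,
          ← ENNReal.ofReal_mul (by positivity), Real.rpow_sub hσ, Real.rpow_natCast,
          Real.rpow_natCast]
        congr 1; rw [div_pow]; field_simp

/-- The good basis `T` varies with `β`, so its kernel product is dominated by the sum over all row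
bases, which can be integrated termwise. -/
theorem exists_betaLikelihood_le_of_residual {X : Matrix (Fin n) (Fin k) ℝ}
    (y : Fin n → ℝ) (hkn : k ≤ n) {δ : ℝ} (hδ : 0 < δ)
    (hres : ∀ β, ∃ T, IsRowBasis X T ∧ ∀ i ∉ T, δ ≤ |y i - X.mulVec β i|)
    {a b : ℝ} (ha : 0 < a) (hb : 0 < b) : ∃ K : ℝ, 0 ≤ K ∧
      ∀ γ ∈ Icc a b, ∀ ν > 2, ∀ σ > 0,
        betaLikelihood X y σ (γ, ν) ≤ ENNReal.ofReal (K * σ ^ ((n : ℝ) - k)) := by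
  classical
  obtain ⟨C, hC, hCle⟩ := exists_ctptPDF_le ha hb
  have hK : ∀ T : Finset (Fin n), ∃ K : ℝ, 0 ≤ K ∧ (IsRowBasis X T → ∀ σ > 0,
      ∫⁻ β : Fin k → ℝ, ENNReal.ofReal (∏ i ∈ T, cauchyKernel ((y i - X.mulVec β i) / σ)) =
        ENNReal.ofReal (K * σ ^ k)) := fun T => by
    by_cases hT : IsRowBasis X T
    · obtain ⟨K, h0, h⟩ := exists_lintegral_rowBasis X hT y
      exact ⟨K, h0, fun _ => h⟩
    · exact ⟨0, le_rfl, fun h => absurd h hT⟩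
  choose K hK0 hKeq using hK
  let B : Finset (Finset (Fin n)) := Finset.univ.filter (IsRowBasis X)
  have hKs : 0 ≤ ∑ T ∈ B, K T := Finset.sum_nonneg fun T _ => hK0 T
  refine ⟨C ^ n * (δ⁻¹ ^ 2) ^ (n - k) * ∑ T ∈ B, K T, by positivity, fun γ hγ ν hν σ hσ => ?_⟩
  have hν' : 0 < ν := by linarith
  have hmeas : ∀ T : Finset (Fin n), Measurable fun β : Fin k → ℝ =>
      ENNReal.ofReal (∏ i ∈ T, cauchyKernel ((y i - X.mulVec β i) / σ)) := fun T => by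
    have h1 := measurable_cauchyKernel
    refine ENNReal.measurable_ofReal.comp (Finset.measurable_prod _ fun i _ => ?_)
    unfold Matrix.mulVec dotProduct
    fun_prop
  have hprod : ∀ (T : Finset (Fin n)) (β : Fin k → ℝ),
      0 ≤ ∏ i ∈ T, cauchyKernel ((y i - X.mulVec β i) / σ) :=
    fun T β => Finset.prod_nonneg fun i _ => (cauchyKernel_pos _).le
  calc betaLikelihood X y σ (γ, ν)
      ≤ ∫⁻ β : Fin k → ℝ, ENNReal.ofReal ((C / σ) ^ n * ((σ / δ) ^ 2) ^ (n - k)) *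
        ∑ T ∈ B, ENNReal.ofReal (∏ i ∈ T, cauchyKernel ((y i - X.mulVec β i) / σ)) := by
        refine lintegral_mono fun β => ?_
        rw [← ENNReal.ofReal_sum_of_nonneg fun T _ => hprod T β,
          ← ENNReal.ofReal_mul (by positivity)]
        refine ENNReal.ofReal_le_ofReal ((likelihood_le X y hσ (ha.trans_le hγ.1) hν'
          (hCle γ hγ ν hν) β).trans ?_)
        rw [mul_assoc]
        refine mul_le_mul_of_nonneg_left ?_ (by positivity)
        obtain ⟨T, hT, hTres⟩ := hres β
        refine (prod_cauchyKernel_le_of_residual X y hδ hσ β hT.2 hTres).trans ?_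
        refine mul_le_mul_of_nonneg_left ?_ (by positivity)
        exact Finset.single_le_sum
          (f := fun T => ∏ i ∈ T, cauchyKernel ((y i - X.mulVec β i) / σ))
          (fun T _ => hprod T β) (Finset.mem_filter.mpr ⟨Finset.mem_univ _, hT⟩)
    _ = ENNReal.ofReal ((C / σ) ^ n * ((σ / δ) ^ 2) ^ (n - k)) *
        ∑ T ∈ B, ENNReal.ofReal (K T * σ ^ k) := by
        rw [lintegral_const_mul' _ _ ENNReal.ofReal_ne_top,
          lintegral_finsetSum _ fun T _ => hmeas T]
        congr 1
        exact Finset.sum_congr rfl fun T hT => hKeq T (Finset.mem_filter.mp hT).2 σ hσ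
    _ = _ := by
        rw [← ENNReal.ofReal_sum_of_nonneg fun T _ => mul_nonneg (hK0 T) (by positivity),
          ← ENNReal.ofReal_mul (by positivity), ← Finset.sum_mul, Real.rpow_sub hσ,
          Real.rpow_natCast, Real.rpow_natCast]
        congr 1
        obtain ⟨m, rfl⟩ := Nat.exists_eq_add_of_le hkn
        simp only [Nat.add_sub_cancel_left]
        rw [pow_add σ, ← pow_mul, ← pow_mul, div_pow, div_pow, pow_add σ, inv_pow]
        field_simp
        ring

theorem exists_le_betaLikelihood (X : Matrix (Fin n) (Fin k) ℝ) (y : Fin n → ℝ) {γ ν : ℝ}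
    (hγ : 0 < γ) (hν : 0 < ν) : ∃ c : ℝ, 0 < c ∧
      ∀ σ ≥ 1, ENNReal.ofReal (c * σ ^ ((k : ℝ) - n)) ≤ betaLikelihood X y σ (γ, ν) := by
  -- This radius bounds every `|residual| / σ` when `σ ≥ 1` and all `|β j| ≤ σ`.
  obtain ⟨c, hc, hcle⟩ := exists_le_ctptPDF hγ hν (∑ i, |y i| + ∑ i, ∑ j, |X i j|)
  refine ⟨c ^ n * 2 ^ k, by positivity, fun σ hσ => ?_⟩
  have hσ0 : 0 < σ := by linarith
  have key : ∀ β ∈ Metric.closedBall (0 : Fin k → ℝ) σ,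
      ENNReal.ofReal ((σ⁻¹ * c) ^ n) ≤ ENNReal.ofReal (likelihood X y (β, σ, γ, ν)) := by
    intro β hβ
    refine ENNReal.ofReal_le_ofReal ?_
    have h1 : (σ⁻¹ * c) ^ n = ∏ _i : Fin n, σ⁻¹ * c := by simp
    rw [h1]
    refine Finset.prod_le_prod (fun i _ => by positivity) fun i _ => ?_
    refine mul_le_mul_of_nonneg_left (hcle _ ?_) (by positivity)
    have hβ' : ∀ j, |β j| ≤ σ := fun j => by
      have := norm_le_pi_norm β j
      rw [mem_closedBall_zero_iff] at hβ
      exact this.trans hβ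
    have h2 : |X.mulVec β i| ≤ (∑ j, |X i j|) * σ := by
      unfold Matrix.mulVec dotProduct
      rw [Finset.sum_mul]
      refine (Finset.abs_sum_le_sum_abs _ _).trans (Finset.sum_le_sum fun j _ => ?_)
      rw [abs_mul]
      exact mul_le_mul_of_nonneg_left (hβ' j) (abs_nonneg _)
    have h3 : |y i| ≤ ∑ i, |y i| :=
      Finset.single_le_sum (f := fun i => |y i|) (fun i _ => abs_nonneg _) (Finset.mem_univ i)
    have h4 : ∑ j, |X i j| ≤ ∑ i, ∑ j, |X i j| :=
      Finset.single_le_sum (f := fun i => ∑ j, |X i j|)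
        (fun i _ => Finset.sum_nonneg fun j _ => abs_nonneg _) (Finset.mem_univ i)
    rw [abs_div, abs_of_pos hσ0, div_le_iff₀ hσ0]
    have h5 := abs_sub (y i) (X.mulVec β i)
    have h6 : (∑ j, |X i j|) * σ ≤ (∑ i, ∑ j, |X i j|) * σ := by gcongr
    have h7 : ∑ i, |y i| ≤ (∑ i, |y i|) * σ :=
      le_mul_of_one_le_right (Finset.sum_nonneg fun i _ => abs_nonneg _) hσ
    linarith
  calc _ = ∫⁻ _β in Metric.closedBall (0 : Fin k → ℝ) σ, ENNReal.ofReal ((σ⁻¹ * c) ^ n) := by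
        rw [setLIntegral_const, Real.volume_pi_closedBall _ hσ0.le, Fintype.card_fin,
          ← ENNReal.ofReal_mul (by positivity), Real.rpow_sub hσ0, Real.rpow_natCast,
          Real.rpow_natCast]
        congr 1
        rw [mul_pow, mul_pow, inv_pow]
        field_simp
    _ ≤ ∫⁻ β in Metric.closedBall (0 : Fin k → ℝ) σ,
        ENNReal.ofReal (likelihood X y (β, σ, γ, ν)) :=
        setLIntegral_mono' Metric.isClosed_closedBall.measurableSet key
    _ ≤ _ := setLIntegral_le_lintegral _ _

/-! ### Evidence and moments as iterated integrals -/

theorem lintegral_scalePrior (f : ℝ → ℝ≥0∞) (hf : Measurable f) :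
    ∫⁻ σ, f σ ∂scalePrior = ∫⁻ σ in Ioi 0, ENNReal.ofReal σ⁻¹ * f σ := by
  unfold scalePrior
  rw [lintegral_withDensity_eq_lintegral_mul _ (by fun_prop) hf]
  rfl

instance : SFinite scalePrior := by unfold scalePrior; infer_instance

theorem lintegral_prior (Pγ Pν : Measure ℝ) [SFinite Pγ] [SFinite Pν]
    {F : Param k → ℝ≥0∞} (hF : Measurable F) : ∫⁻ θ, F θ ∂(prior k Pγ Pν) =
      ∫⁻ q, ∫⁻ σ, ∫⁻ β : Fin k → ℝ, F (β, σ, q) ∂volume ∂scalePrior ∂(Pγ.prod Pν) := by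
  unfold prior
  rw [lintegral_prod_symm' _ hF, lintegral_prod_symm' _ hF.lintegral_prod_left']

/-- The evidence-weighted moment of `σ` for fixed skewness and tail parameters. -/
noncomputable def conditionalMoment (X : Matrix (Fin n) (Fin k) ℝ) (y : Fin n → ℝ) (r : ℝ)
    (q : ℝ × ℝ) : ℝ≥0∞ :=
  ∫⁻ σ, ∫⁻ β : Fin k → ℝ, ENNReal.ofReal (σ ^ r) *
    ENNReal.ofReal (likelihood X y (β, σ, q)) ∂volume ∂scalePrior

theorem measurable_moment_integrand (X : Matrix (Fin n) (Fin k) ℝ) (y : Fin n → ℝ) (r : ℝ) :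
    Measurable fun θ : Param k =>
      ENNReal.ofReal (θ.2.1 ^ r) * ENNReal.ofReal (likelihood X y θ) := by
  have := measurable_likelihood X y
  fun_prop

theorem measurable_conditionalMoment (X : Matrix (Fin n) (Fin k) ℝ) (y : Fin n → ℝ) (r : ℝ) :
    Measurable (conditionalMoment X y r) := by
  have h := (measurable_moment_integrand X y r).lintegral_prod_left' (μ := volume)
  exact h.lintegral_prod_left' (μ := scalePrior)

theorem conditionalMoment_eq (X : Matrix (Fin n) (Fin k) ℝ) (y : Fin n → ℝ) (r : ℝ)
    (q : ℝ × ℝ) : conditionalMoment X y r q =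
      ∫⁻ σ in Ioi 0, ENNReal.ofReal (σ ^ (r - 1)) * betaLikelihood X y σ q := by
  have hm := (measurable_moment_integrand X y r).lintegral_prod_left' (μ := volume)
  refine (lintegral_scalePrior _
    (hm.comp (by fun_prop : Measurable fun σ : ℝ => (σ, q)))).trans ?_
  refine setLIntegral_congr_fun measurableSet_Ioi fun σ hσ => ?_
  have hσ : 0 < σ := hσ
  simp only [Function.comp_apply]
  rw [lintegral_const_mul' _ _ ENNReal.ofReal_ne_top, ← mul_assoc,
    ← ENNReal.ofReal_mul (by positivity), Real.rpow_sub_one hσ.ne', div_eq_inv_mul]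
  rfl

theorem evidence_eq (X : Matrix (Fin n) (Fin k) ℝ) (y : Fin n → ℝ) (Pγ Pν : Measure ℝ)
    [SFinite Pγ] [SFinite Pν] :
    evidence X y Pγ Pν = ∫⁻ q, conditionalMoment X y 0 q ∂(Pγ.prod Pν) := by
  unfold conditionalMoment
  rw [← lintegral_prior Pγ Pν (measurable_moment_integrand X y 0)]
  unfold evidence unnormalizedPosterior
  rw [withDensity_apply _ MeasurableSet.univ]
  simp

theorem scaleMoment_eq (X : Matrix (Fin n) (Fin k) ℝ) (y : Fin n → ℝ) (Pγ Pν : Measure ℝ)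
    [SFinite Pγ] [SFinite Pν] (r : ℝ) : scaleMoment X y Pγ Pν r =
      (evidence X y Pγ Pν)⁻¹ * ∫⁻ q, conditionalMoment X y r q ∂(Pγ.prod Pν) := by
  unfold conditionalMoment
  rw [← lintegral_prior Pγ Pν (measurable_moment_integrand X y r)]
  unfold scaleMoment posterior unnormalizedPosterior
  rw [lintegral_smul_measure, lintegral_withDensity_eq_lintegral_mul _
    (measurable_likelihood X y).ennreal_ofReal (by fun_prop), smul_eq_mul]
  congr 1
  exact lintegral_congr fun θ => mul_comm (ENNReal.ofReal _) (ENNReal.ofReal _)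

theorem ae_mem_of_compl_null {Pγ Pν : Measure ℝ} [SFinite Pγ] [SFinite Pν] {s t : Set ℝ}
    (hs : Pγ sᶜ = 0) (ht : Pν tᶜ = 0) : ∀ᵐ q ∂(Pγ.prod Pν), q.1 ∈ s ∧ q.2 ∈ t := by
  have h1 : ∀ᵐ x ∂Pγ, x ∈ s := by rwa [ae_iff]
  have h2 : ∀ᵐ x ∂Pν, x ∈ t := by rwa [ae_iff]
  exact (Measure.quasiMeasurePreserving_fst.ae h1).and (Measure.quasiMeasurePreserving_snd.ae h2)

/-! ### Integration over small and large scales -/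

theorem lintegral_Ioi_rpow_lt_top {s : ℝ} (hs : s < -1) :
    ∫⁻ σ in Ioi (1 : ℝ), ENNReal.ofReal (σ ^ s) < ∞ := by
  have h := (integrableOn_Ioi_rpow_iff (s := s) zero_lt_one).mpr hs
  exact h.lintegral_lt_top

theorem lintegral_Ioi_rpow_eq_top {s : ℝ} (hs : -1 ≤ s) :
    ∫⁻ σ in Ioi (1 : ℝ), ENNReal.ofReal (σ ^ s) = ∞ := by
  by_contra h
  have h1 : IntegrableOn (fun σ : ℝ => σ ^ s) (Ioi 1) := by
    refine (lintegral_ofReal_ne_top_iff_integrable (by fun_prop) ?_).mp h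
    filter_upwards [ae_restrict_mem measurableSet_Ioi] with σ hσ
    exact Real.rpow_nonneg (zero_le_one.trans (le_of_lt hσ)) _
  have := (integrableOn_Ioi_rpow_iff zero_lt_one).mp h1
  linarith

theorem lintegral_Ioi_rpow_pos (s : ℝ) : 0 < ∫⁻ σ in Ioi (1 : ℝ), ENNReal.ofReal (σ ^ s) := by
  rw [setLIntegral_pos_iff (by fun_prop)]
  have : Ioi (1 : ℝ) ⊆ (Function.support fun σ : ℝ => ENNReal.ofReal (σ ^ s)) ∩ Ioi 1 := by
    intro σ hσ
    refine ⟨?_, hσ⟩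
    have : (0 : ℝ) < σ := zero_lt_one.trans hσ
    simp [Function.mem_support, Real.rpow_pos_of_pos this]
  exact lt_of_lt_of_le (by simp) (measure_mono this)

theorem lintegral_Ioc_rpow_lt_top {s : ℝ} (hs : -1 < s) :
    ∫⁻ σ in Ioc (0 : ℝ) 1, ENNReal.ofReal (σ ^ s) < ∞ := by
  have h := (intervalIntegral.intervalIntegrable_rpow' (a := 0) (b := 1) hs).1
  exact h.lintegral_lt_top

/-- Splits the integral over the scale at `1`. -/
theorem conditionalMoment_split (X : Matrix (Fin n) (Fin k) ℝ) (y : Fin n → ℝ) (r : ℝ)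
    (q : ℝ × ℝ) : conditionalMoment X y r q =
      (∫⁻ σ in Ioc 0 1, ENNReal.ofReal (σ ^ (r - 1)) * betaLikelihood X y σ q) +
      ∫⁻ σ in Ioi 1, ENNReal.ofReal (σ ^ (r - 1)) * betaLikelihood X y σ q := by
  rw [conditionalMoment_eq, ← Ioc_union_Ioi_eq_Ioi zero_le_one,
    lintegral_union measurableSet_Ioi]
  exact Set.disjoint_left.mpr fun x hx hx' => not_lt.mpr hx.2 hx'

theorem setLIntegral_rpow_mul_le {s : Set ℝ} (hs : MeasurableSet s) (hs0 : ∀ σ ∈ s, 0 < σ)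
    {f : ℝ → ℝ≥0∞} {K p q : ℝ} (hK : 0 ≤ K)
    (hf : ∀ σ ∈ s, f σ ≤ ENNReal.ofReal (K * σ ^ q)) :
    ∫⁻ σ in s, ENNReal.ofReal (σ ^ p) * f σ ≤
      ENNReal.ofReal K * ∫⁻ σ in s, ENNReal.ofReal (σ ^ (p + q)) := by
  rw [← lintegral_const_mul' _ _ ENNReal.ofReal_ne_top]
  refine setLIntegral_mono' hs fun σ hσ => ?_
  have h0 := hs0 σ hσ
  calc _ ≤ ENNReal.ofReal (σ ^ p) * ENNReal.ofReal (K * σ ^ q) := by gcongr; exact hf σ hσ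
    _ = _ := by
      rw [← ENNReal.ofReal_mul (by positivity), ← ENNReal.ofReal_mul hK, Real.rpow_add h0]
      congr 1; ring

/-- Only `σ > 1` is kept; this serves both positivity of the evidence and divergence of high
moments. -/
theorem exists_le_conditionalMoment (X : Matrix (Fin n) (Fin k) ℝ) (y : Fin n → ℝ) {γ ν : ℝ}
    (hγ : 0 < γ) (hν : 0 < ν) (r : ℝ) : ∃ c : ℝ≥0∞, 0 < c ∧
      c * (∫⁻ σ in Ioi (1 : ℝ), ENNReal.ofReal (σ ^ (r - 1 + (k - n)))) ≤
        conditionalMoment X y r (γ, ν) := by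
  obtain ⟨c, hc, h⟩ := exists_le_betaLikelihood X y hγ hν
  refine ⟨ENNReal.ofReal c, ENNReal.ofReal_pos.mpr hc, ?_⟩
  rw [conditionalMoment_split]
  refine le_trans ?_ le_add_self
  rw [← lintegral_const_mul' _ _ ENNReal.ofReal_ne_top]
  refine setLIntegral_mono' measurableSet_Ioi fun σ hσ => ?_
  have h0 : 0 < σ := zero_lt_one.trans hσ
  calc ENNReal.ofReal c * ENNReal.ofReal (σ ^ (r - 1 + (k - n)))
      = ENNReal.ofReal (σ ^ (r - 1)) * ENNReal.ofReal (c * σ ^ ((k : ℝ) - n)) := by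
        rw [← ENNReal.ofReal_mul hc.le, ← ENNReal.ofReal_mul (by positivity), Real.rpow_add h0]
        congr 1; ring
    _ ≤ _ := by gcongr; exact h σ (le_of_lt hσ)

theorem conditionalMoment_pos (X : Matrix (Fin n) (Fin k) ℝ) (y : Fin n → ℝ) {γ ν : ℝ}
    (hγ : 0 < γ) (hν : 0 < ν) (r : ℝ) : 0 < conditionalMoment X y r (γ, ν) := by
  obtain ⟨c, hc, h⟩ := exists_le_conditionalMoment X y hγ hν r
  exact (ENNReal.mul_pos hc.ne' (lintegral_Ioi_rpow_pos _).ne').trans_le h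

theorem conditionalMoment_eq_top (X : Matrix (Fin n) (Fin k) ℝ) (y : Fin n → ℝ) {γ ν : ℝ}
    (hγ : 0 < γ) (hν : 0 < ν) {r : ℝ} (hr : (n : ℝ) - k ≤ r) :
    conditionalMoment X y r (γ, ν) = ∞ := by
  obtain ⟨c, hc, h⟩ := exists_le_conditionalMoment X y hγ hν r
  rw [lintegral_Ioi_rpow_eq_top (by linarith), ENNReal.mul_top hc.ne'] at h
  exact top_le_iff.mp h

theorem exists_lintegral_large_scale_le {X : Matrix (Fin n) (Fin k) ℝ} (hX : X.rank = k)
    (y : Fin n → ℝ) {a b r : ℝ} (ha : 0 < a) (hb : 0 < b) (hr : r < (n : ℝ) - k) :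
    ∃ D < ∞, ∀ γ ∈ Icc a b, ∀ ν > 2,
      ∫⁻ σ in Ioi 1, ENNReal.ofReal (σ ^ (r - 1)) * betaLikelihood X y σ (γ, ν) ≤ D := by
  obtain ⟨K, hK, h⟩ := exists_betaLikelihood_le hX y ha hb
  refine ⟨_, ENNReal.mul_lt_top (a := ENNReal.ofReal K) ENNReal.ofReal_lt_top
    (lintegral_Ioi_rpow_lt_top (s := r - 1 + (k - n)) (by linarith)), fun γ hγ ν hν => ?_⟩
  have h0 : ∀ σ ∈ Ioi (1 : ℝ), 0 < σ := fun σ hσ => zero_lt_one.trans hσ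
  exact setLIntegral_rpow_mul_le measurableSet_Ioi h0 hK fun σ hσ => h γ hγ ν hν σ (h0 σ hσ)

theorem exists_lintegral_small_scale_le {X : Matrix (Fin n) (Fin k) ℝ}
    (y : Fin n → ℝ) (hkn : k < n) {δ : ℝ} (hδ : 0 < δ)
    (hres : ∀ β, ∃ T, IsRowBasis X T ∧ ∀ i ∉ T, δ ≤ |y i - X.mulVec β i|)
    {a b : ℝ} (ha : 0 < a) (hb : 0 < b) :
    ∃ D < ∞, ∀ γ ∈ Icc a b, ∀ ν > 2,
      ∫⁻ σ in Ioc 0 1, ENNReal.ofReal (σ ^ ((0 : ℝ) - 1)) * betaLikelihood X y σ (γ, ν) ≤ D := by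
  obtain ⟨K, hK, h⟩ := exists_betaLikelihood_le_of_residual y hkn.le hδ hres ha hb
  have hkn' : (k : ℝ) < n := by exact_mod_cast hkn
  refine ⟨_, ENNReal.mul_lt_top (a := ENNReal.ofReal K) ENNReal.ofReal_lt_top
    (lintegral_Ioc_rpow_lt_top (s := 0 - 1 + (n - k)) (by linarith)), fun γ hγ ν hν => ?_⟩
  exact setLIntegral_rpow_mul_le measurableSet_Ioc (fun σ hσ => hσ.1) hK
    fun σ hσ => h γ hγ ν hν σ hσ.1

/-- Compares the small-scale part of a moment with that of the evidence, so that (i) needs no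
genericity of `y`. -/
theorem setLIntegral_small_scale_anti {r : ℝ} (hr : 0 ≤ r) (f : ℝ → ℝ≥0∞) :
    ∫⁻ σ in Ioc (0 : ℝ) 1, ENNReal.ofReal (σ ^ (r - 1)) * f σ ≤
      ∫⁻ σ in Ioc (0 : ℝ) 1, ENNReal.ofReal (σ ^ ((0 : ℝ) - 1)) * f σ := by
  refine setLIntegral_mono' measurableSet_Ioc fun σ hσ => ?_
  gcongr ENNReal.ofReal ?_ * _
  exact Real.rpow_le_rpow_of_exponent_ge hσ.1 hσ.2 (by linarith)

/-- Full column rank with `k = n` would make `X` surjective. -/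
theorem lt_of_notMem_range_mulVec {X : Matrix (Fin n) (Fin k) ℝ} (hX : X.rank = k)
    {y : Fin n → ℝ} (hy : y ∉ range X.mulVec) : k < n := by
  have h1 : X.rank ≤ n := by simpa using X.rank_le_height
  refine lt_of_le_of_ne (hX ▸ h1) fun hkn => hy ?_
  have h2 : LinearMap.range X.mulVecLin = ⊤ := by
    apply Submodule.eq_top_of_finrank_eq
    rw [Module.finrank_fin_fun]
    exact hX.trans hkn
  have h3 : y ∈ LinearMap.range X.mulVecLin := h2 ▸ Submodule.mem_top
  exact h3

/-! ### Moment criterion and propriety -/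

theorem scaleMoment_lt_top_iff {X : Matrix (Fin n) (Fin k) ℝ} (hX : X.rank = k) (y : Fin n → ℝ)
    {Pγ Pν : Measure ℝ} (hP : AdmissiblePriors Pγ Pν) (hproper : PosteriorProper X y Pγ Pν)
    {r : ℝ} (hr : 0 ≤ r) : scaleMoment X y Pγ Pν r < ∞ ↔ r < (n : ℝ) - k := by
  obtain ⟨hγ, hν, ⟨a, b, ha, ha1, hb1, hab⟩, htail⟩ := hP
  obtain ⟨hpos, hfin⟩ := hproper
  have hae := ae_mem_of_compl_null hab htail
  rw [scaleMoment_eq]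
  constructor
  · contrapose!
    intro hrn
    have h1 : ∫⁻ q, conditionalMoment X y r q ∂(Pγ.prod Pν) = ∞ := by
      have : ∀ᵐ q ∂(Pγ.prod Pν), conditionalMoment X y r q = ∞ := by
        filter_upwards [hae] with q hq
        exact conditionalMoment_eq_top X y (ha.trans_le hq.1.1) (zero_lt_two.trans hq.2) hrn
      rw [lintegral_congr_ae this]
      simp
    -- Finiteness of the evidence keeps its inverse nonzero, so the product with `∞` is `∞`.
    rw [h1, ENNReal.mul_top (ENNReal.inv_ne_zero.mpr hfin.ne)]
  · intro hrn
    obtain ⟨D, hD, hle⟩ := exists_lintegral_large_scale_le hX y ha (zero_lt_one.trans_le hb1) hrn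
    refine ENNReal.mul_lt_top (ENNReal.inv_lt_top.mpr hpos) ?_
    calc ∫⁻ q, conditionalMoment X y r q ∂(Pγ.prod Pν)
        ≤ ∫⁻ q, (conditionalMoment X y 0 q + D) ∂(Pγ.prod Pν) := by
          refine lintegral_mono_ae ?_
          filter_upwards [hae] with q hq
          rw [conditionalMoment_split X y r, conditionalMoment_split X y 0]
          refine add_le_add ?_ (hle q.1 hq.1 q.2 hq.2)
          exact (setLIntegral_small_scale_anti hr _).trans le_self_add
      _ = evidence X y Pγ Pν + D := by
          rw [lintegral_add_right _ measurable_const, ← evidence_eq]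
          simp
      _ < ∞ := ENNReal.add_lt_top.mpr ⟨hfin, hD⟩

theorem posteriorProper_of_residual {X : Matrix (Fin n) (Fin k) ℝ} (hX : X.rank = k)
    {y : Fin n → ℝ} (hkn : k < n) {δ : ℝ} (hδ : 0 < δ)
    (hres : ∀ β, ∃ T, IsRowBasis X T ∧ ∀ i ∉ T, δ ≤ |y i - X.mulVec β i|)
    {Pγ Pν : Measure ℝ} (hP : AdmissiblePriors Pγ Pν) : PosteriorProper X y Pγ Pν := by
  obtain ⟨hγ, hν, ⟨a, b, ha, ha1, hb1, hab⟩, htail⟩ := hP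
  have hae := ae_mem_of_compl_null hab htail
  have hb : 0 < b := zero_lt_one.trans_le hb1
  rw [PosteriorProper, evidence_eq]
  constructor
  -- Zero evidence would force the conditional moment to vanish almost everywhere, yet it is
  -- positive at almost every `(γ, ν)`.
  · rw [pos_iff_ne_zero, Ne, lintegral_eq_zero_iff (measurable_conditionalMoment X y 0)]
    intro h0
    have : ∀ᵐ q ∂(Pγ.prod Pν), False := by
      filter_upwards [hae, h0] with q hq hq0
      exact (conditionalMoment_pos X y (ha.trans_le hq.1.1) (zero_lt_two.trans hq.2) 0).ne' hq0
    exact this.exists.elim fun _ h => h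
  · have hkn' : (k : ℝ) < n := by exact_mod_cast hkn
    obtain ⟨D, hD, hle⟩ :=
      exists_lintegral_large_scale_le (r := 0) hX y ha hb (by linarith)
    obtain ⟨D', hD', hle'⟩ := exists_lintegral_small_scale_le y hkn hδ hres ha hb
    calc ∫⁻ q, conditionalMoment X y 0 q ∂(Pγ.prod Pν)
        ≤ ∫⁻ _q, (D' + D) ∂(Pγ.prod Pν) := by
          refine lintegral_mono_ae ?_
          filter_upwards [hae] with q hq
          rw [conditionalMoment_split]
          exact add_le_add (hle' q.1 hq.1 q.2 hq.2) (hle q.1 hq.1 q.2 hq.2)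
      _ = D' + D := by simp
      _ < ∞ := ENNReal.add_lt_top.mpr ⟨hD', hD⟩

end CTPT

theorem theorem5 (n k : ℕ) (X : Matrix (Fin n) (Fin k) ℝ) (hX : X.rank = k) :
    (∀ y : Fin n → ℝ, y ∉ Set.range X.mulVec →
      ∀ Pγ Pν : MeasureTheory.Measure ℝ, CTPT.AdmissiblePriors Pγ Pν →
        CTPT.PosteriorProper X y Pγ Pν →
          ∀ r : ℝ, 0 ≤ r →
            (CTPT.scaleMoment X y Pγ Pν r < ⊤ ↔ r < (n : ℝ) - (k : ℝ))) ∧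
    (∀ᵐ y : Fin n → ℝ, y ∉ Set.range X.mulVec →
      ∀ Pγ Pν : MeasureTheory.Measure ℝ, CTPT.AdmissiblePriors Pγ Pν →
        CTPT.PosteriorProper X y Pγ Pν) := by
  refine ⟨fun y _ Pγ Pν hP hproper r hr => CTPT.scaleMoment_lt_top_iff hX y hP hproper hr, ?_⟩
  filter_upwards [CTPT.ae_exists_residual_bound hX] with y ⟨δ, hδ, hres⟩ hy Pγ Pν hP
  exact CTPT.posteriorProper_of_residual hX (CTPT.lt_of_notMem_range_mulVec hX hy) hδ hres hP
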